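/- **Proposition 2.3 (subspace Poincaré inequality).** Let $m\in\mathbb{R}^d$, let $\Sigma\in\mathbb{R}^{d\times d}$ be symmetric positive definite, and let $\mu=\mathcal{N}(m,\Sigma)$ be the Gaussian probability measure on $\mathbb{R}^d$ with mean $m$ and covariance matrix $\Sigma$. Write $\|v\|_\Sigma^2=v^T\Sigma v$ for $v\in\mathbb{R}^d$. Let $P_r\in\mathbb{R}^{d\times d}$ be any projector, i.e. $P_r^2=P_r$ (of any rank, not necessarily orthogonal), and let $\sigma(P_r)$ be the $\sigma$-algebra on $\mathbb{R}^d$ generated by the map $x\mapsto P_r x$. Then for every continuously differentiable function $h:\mathbb{R}^d\to\mathbb{R}$ that is $\mu$-integrable (so that the conditional expectation $\mathbb{E}_\mu(h\,|\,\sigma(P_r))$ is defined), $$ \int_{\mathbb{R}^d} \big(h-\mathbb{E}_\mu(h\,|\,\sigma(P_r))\big)^2\,\mathrm{d}\mu \;\le\; \int_{\mathbb{R}^d} \big\|(I_d-P_r^T)\nabla h\big\|_\Sigma^2\,\mathrm{d}\mu , $$ where $I_d$ is the $d\times d$ identity matrix and both integrals are taken in $[0,\infty]$. In particular, the left-hand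 side is finite whenever the right-hand side is. -/

import Mathlib

open MeasureTheory ProbabilityTheory
open scoped Matrix

/-- The σ-algebra `σ(P)` on `ℝ^d` generated by the linear map `x ↦ P x`: the preimages under this
map of the Borel subsets of `ℝ^d`. -/
@[reducible] noncomputable def sigmaAlgebraOf {d : ℕ} (P : Matrix (Fin d) (Fin d) ℝ) :
    MeasurableSpace (EuclideanSpace ℝ (Fin d)) :=
  (inferInstance : MeasurableSpace (EuclideanSpace ℝ (Fin d))).comap
    (fun x => Matrix.toEuclideanCLM (𝕜 := ℝ) P x)

/-- `σ(P)` is contained in the Borel σ-algebra, so that conditioning on it is meaningful. -/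
theorem sigmaAlgebraOf_le {d : ℕ} (P : Matrix (Fin d) (Fin d) ℝ) :
    sigmaAlgebraOf P ≤ (inferInstance : MeasurableSpace (EuclideanSpace ℝ (Fin d))) :=
  (Matrix.toEuclideanCLM (𝕜 := ℝ) P).continuous.measurable.comap_le

/-- The squared norm `‖v‖_S² = vᵀ S v`. -/
noncomputable def weightedNormSq {d : ℕ} (S : Matrix (Fin d) (Fin d) ℝ) (v : EuclideanSpace ℝ (Fin d)) : ℝ :=
  inner ℝ v (Matrix.toEuclideanCLM (𝕜 := ℝ) S v)

/-! Write `S = B * B` with `B` symmetric, so that `μ` is the law of `m + B Z` with `Z` standard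
Gaussian. Put `K = ker (P B)` and split `Z = Z₁ + Z₂` into independent standard Gaussians on `Kᗮ`
and `K`. Since `P` is idempotent and `B` invertible, `P (m + B Z)` carries the same information as
`Z₁`; conditioning on it integrates out `Z₂` (`condExp_map_prod_ae_eq`). For fixed `Z₁` the claim is
the Poincaré inequality on `K`, since for `k ∈ K` one has `B k = (1 - P) B k`, and the derivative
along `B k` is `⟪B (1 - Pᵀ) ∇h, k⟫`.

The Poincaré inequality is proved for `doubleVar`, so no square integrability is needed. On the
line, Cauchy–Schwarz bounds `(f x - f y) ^ 2` by `|y - x| ∫ f' ^ 2`; averaging over two independent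
Gaussian points gives `f' s ^ 2` exactly the weight `2 φ(s)`, with `φ` the Gaussian density.
Subadditivity over products (`doubleVar_prod_le`) lifts this to all finite dimensions. -/

/-! ### Doubled variance and tensorization. -/

/-- Twice the variance of `f`, written as the expected squared difference of two independent
copies; it takes values in `[0, ∞]` and needs no integrability. -/
noncomputable def doubleVar {X : Type*} [MeasurableSpace X] (μ : Measure X) (f : X → ℝ) :
    ENNReal :=
  ∫⁻ x, ∫⁻ y, ENNReal.ofReal ((f x - f y) ^ 2) ∂μ ∂μ

theorem doubleVar_map {X Y : Type*} [MeasurableSpace X] [MeasurableSpace Y] (μ : Measure X)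
    [SFinite μ] {T : X → Y} (hT : Measurable T) {f : Y → ℝ} (hf : Measurable f) :
    doubleVar (μ.map T) f = doubleVar μ (f ∘ T) := by
  unfold doubleVar
  rw [lintegral_map (Measurable.lintegral_prod_right' (f := fun p : Y × Y =>
    ENNReal.ofReal ((f p.1 - f p.2) ^ 2)) (by fun_prop)) hT]
  refine lintegral_congr fun x => ?_
  rw [lintegral_map (by fun_prop) hT]
  rfl

/-- The sum of the squares of the diagonals of a quadrilateral is at most that of its sides. -/
theorem sq_diagonals_le_sq_sides (a b c d : ℝ) :
    (a - d) ^ 2 + (b - c) ^ 2 ≤ (a - b) ^ 2 + (c - d) ^ 2 + ((a - c) ^ 2 + (b - d) ^ 2) := by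
  nlinarith [sq_nonneg (a + d - b - c)]

/-- The four values of `F` on `{x, x'} × {y, y'}` form a quadrilateral. By symmetry both diagonals
average to the left side, and opposite sides have equal averages; the common factor 2 cancels. -/
theorem doubleVar_prod_le {X Y : Type*} [MeasurableSpace X] [MeasurableSpace Y]
    (μ : Measure X) (ν : Measure Y) [IsProbabilityMeasure μ] [IsProbabilityMeasure ν]
    {F : X × Y → ℝ} (hF : Measurable F) :
    doubleVar (μ.prod ν) F ≤
      ∫⁻ x, doubleVar ν (fun y => F (x, y)) ∂μ + ∫⁻ y, doubleVar μ (fun x => F (x, y)) ∂ν := by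
  have key : ∀ x x' y y', ENNReal.ofReal ((F (x, y) - F (x', y')) ^ 2)
      + ENNReal.ofReal ((F (x, y') - F (x', y)) ^ 2) ≤
      ENNReal.ofReal ((F (x, y) - F (x, y')) ^ 2) + ENNReal.ofReal ((F (x', y) - F (x', y')) ^ 2)
      + (ENNReal.ofReal ((F (x, y) - F (x', y)) ^ 2)
        + ENNReal.ofReal ((F (x, y') - F (x', y')) ^ 2)) := by
    intro x x' y y'
    rw [← ENNReal.ofReal_add (by positivity) (by positivity),
      ← ENNReal.ofReal_add (by positivity) (by positivity),
      ← ENNReal.ofReal_add (by positivity) (by positivity),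
      ← ENNReal.ofReal_add (by positivity) (by positivity)]
    exact ENNReal.ofReal_le_ofReal (sq_diagonals_le_sq_sides _ _ _ _)
  let κ := (μ.prod ν).prod (μ.prod ν)
  have hprod : ∀ G : (X × Y) × X × Y → ENNReal, Measurable G →
      ∫⁻ p, G p ∂κ = ∫⁻ x, ∫⁻ y, ∫⁻ x', ∫⁻ y', G ((x, y), (x', y')) ∂ν ∂μ ∂ν ∂μ := by
    intro G hG
    rw [lintegral_prod _ hG.aemeasurable, lintegral_prod _ hG.lintegral_prod_right'.aemeasurable]
    refine lintegral_congr fun x => lintegral_congr fun y => ?_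
    rw [lintegral_prod _ (by fun_prop)]
  have hD : doubleVar (μ.prod ν) F = ∫⁻ p, ENNReal.ofReal ((F p.1 - F p.2) ^ 2) ∂κ := by
    rw [lintegral_prod _ (by fun_prop)]; rfl
  -- Exchanging `y` and `y'` turns one diagonal into the other.
  have hD' : ∫⁻ p, ENNReal.ofReal ((F (p.1.1, p.2.2) - F (p.2.1, p.1.2)) ^ 2) ∂κ
      = doubleVar (μ.prod ν) F := by
    rw [hD, hprod _ (by fun_prop), hprod _ (by fun_prop)]
    refine lintegral_congr fun x => ?_
    calc ∫⁻ y, ∫⁻ x', ∫⁻ y', ENNReal.ofReal ((F (x, y') - F (x', y)) ^ 2) ∂ν ∂μ ∂ν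
        = ∫⁻ x', ∫⁻ y, ∫⁻ y', ENNReal.ofReal ((F (x, y') - F (x', y)) ^ 2) ∂ν ∂ν ∂μ :=
          lintegral_lintegral_swap (Measurable.aemeasurable (by fun_prop))
      _ = ∫⁻ x', ∫⁻ y, ∫⁻ y', ENNReal.ofReal ((F (x, y) - F (x', y')) ^ 2) ∂ν ∂ν ∂μ :=
          lintegral_congr fun x' => lintegral_lintegral_swap (Measurable.aemeasurable (by fun_prop))
      _ = _ := lintegral_lintegral_swap (Measurable.aemeasurable (by fun_prop))
  have h1 : ∫⁻ p, ENNReal.ofReal ((F (p.1.1, p.1.2) - F (p.1.1, p.2.2)) ^ 2) ∂κ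
      = ∫⁻ x, doubleVar ν (fun y => F (x, y)) ∂μ := by
    rw [hprod _ (by fun_prop)]
    simp [doubleVar]
  have h2 : ∫⁻ p, ENNReal.ofReal ((F (p.2.1, p.1.2) - F (p.2.1, p.2.2)) ^ 2) ∂κ
      = ∫⁻ x, doubleVar ν (fun y => F (x, y)) ∂μ := by
    rw [hprod _ (by fun_prop)]
    simp only [lintegral_const, measure_univ, mul_one, doubleVar]
    exact lintegral_lintegral_swap (Measurable.aemeasurable (by fun_prop))
  have h3 : ∫⁻ p, ENNReal.ofReal ((F (p.1.1, p.1.2) - F (p.2.1, p.1.2)) ^ 2) ∂κ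
      = ∫⁻ y, doubleVar μ (fun x => F (x, y)) ∂ν := by
    rw [hprod _ (by fun_prop)]
    simp only [lintegral_const, measure_univ, mul_one, doubleVar]
    exact lintegral_lintegral_swap (Measurable.aemeasurable (by fun_prop))
  have h4 : ∫⁻ p, ENNReal.ofReal ((F (p.1.1, p.2.2) - F (p.2.1, p.2.2)) ^ 2) ∂κ
      = ∫⁻ y, doubleVar μ (fun x => F (x, y)) ∂ν := by
    rw [hprod _ (by fun_prop)]
    simp only [lintegral_const, measure_univ, mul_one, doubleVar]
    calc ∫⁻ x, ∫⁻ x', ∫⁻ y', ENNReal.ofReal ((F (x, y') - F (x', y')) ^ 2) ∂ν ∂μ ∂μ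
        = ∫⁻ x, ∫⁻ y', ∫⁻ x', ENNReal.ofReal ((F (x, y') - F (x', y')) ^ 2) ∂μ ∂ν ∂μ :=
          lintegral_congr fun x => lintegral_lintegral_swap (Measurable.aemeasurable (by fun_prop))
      _ = _ := lintegral_lintegral_swap (Measurable.aemeasurable (by fun_prop))
  have hsum := lintegral_mono (μ := κ) fun p => key p.1.1 p.2.1 p.1.2 p.2.2
  rw [lintegral_add_left (by fun_prop), lintegral_add_left (by fun_prop),
    lintegral_add_left (by fun_prop), lintegral_add_left (by fun_prop), h1, h2, h3, h4, hD',
    ← hD, ← two_mul, ← two_mul, ← two_mul, ← mul_add] at hsum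
  exact (ENNReal.mul_le_mul_iff_right two_ne_zero ENNReal.ofNat_ne_top).1 hsum

/-! ### Comparison with the variance. -/

/-- Bias–variance decomposition. If the right side is finite then `f` is in `L²` and equality holds.
-/
theorem evariance_add_sq_le_lintegral_sq_sub {X : Type*} [MeasurableSpace X] {μ : Measure X}
    [IsProbabilityMeasure μ] {f : X → ℝ} (hf : Integrable f μ) (c : ℝ) :
    evariance f μ + ENNReal.ofReal ((∫ x, f x ∂μ - c) ^ 2)
      ≤ ∫⁻ x, ENNReal.ofReal ((f x - c) ^ 2) ∂μ := by
  by_cases hfin : ∫⁻ x, ENNReal.ofReal ((f x - c) ^ 2) ∂μ = ⊤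
  · simp [hfin]
  have hsm : AEStronglyMeasurable (fun x => f x - c) μ :=
    hf.aestronglyMeasurable.sub aestronglyMeasurable_const
  have hint : Integrable (fun x => (f x - c) ^ 2) μ := by
    refine ⟨hsm.pow 2, ?_⟩
    rw [hasFiniteIntegral_iff_ofReal (ae_of_all _ fun x => sq_nonneg _)]
    exact lt_top_iff_ne_top.2 hfin
  have hLp : MemLp (fun x => f x - c) 2 μ := (memLp_two_iff_integrable_sq hsm).2 hint
  have hL : MemLp f 2 μ :=
    (memLp_congr_ae (ae_of_all _ fun x => by simp)).1 (hLp.add (memLp_const c))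
  rw [← ofReal_variance hL, ← ENNReal.ofReal_add (variance_nonneg _ _) (sq_nonneg _),
    ← ofReal_integral_eq_lintegral_ofReal hint (ae_of_all _ fun x => sq_nonneg _)]
  refine ENNReal.ofReal_le_ofReal (le_of_eq ?_)
  have h1 := variance_eq_sub hLp
  rw [variance_sub_const hf.aestronglyMeasurable] at h1
  have h2 : ∫ x, (f x - c) ∂μ = ∫ x, f x ∂μ - c := by
    rw [integral_sub hf (integrable_const c)]; simp
  simp only [Pi.pow_apply] at h1
  rw [h1, h2]; ring

/-- Average the decomposition over `c = f x`: the bias term contributes a second variance. -/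
theorem two_mul_evariance_le_doubleVar {X : Type*} [MeasurableSpace X] {μ : Measure X}
    [IsProbabilityMeasure μ] {f : X → ℝ} (hf : Integrable f μ) :
    2 * evariance f μ ≤ doubleVar μ f := by
  calc 2 * evariance f μ
      = ∫⁻ x, (evariance f μ + ENNReal.ofReal ((∫ y, f y ∂μ - f x) ^ 2)) ∂μ := by
        rw [lintegral_add_left measurable_const, lintegral_const, measure_univ, mul_one,
          evariance_eq_lintegral_ofReal, two_mul]
        congr 1
        exact lintegral_congr fun x => by rw [← neg_sub, neg_sq]
    _ ≤ ∫⁻ x, ∫⁻ y, ENNReal.ofReal ((f y - f x) ^ 2) ∂μ ∂μ :=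
        lintegral_mono fun x => evariance_add_sq_le_lintegral_sq_sub hf (f x)
    _ = doubleVar μ f :=
        lintegral_congr fun x => lintegral_congr fun y => by rw [← neg_sub, neg_sq]

/-! ### Conditional expectation as a partial integral. -/

/-- If the law `μ` is the image of a product measure under `Φ`, and `q ∘ Φ` generates the same
information as the first coordinate, then conditioning on `q` integrates out the second one. -/
theorem condExp_map_prod_ae_eq {X Y Z Z' : Type*} [MeasurableSpace X] [MeasurableSpace Y]
    [mZ : MeasurableSpace Z] [mZ' : MeasurableSpace Z'] (μ : Measure X) (ν : Measure Y)
    [IsProbabilityMeasure μ] [IsProbabilityMeasure ν] {Φ : X × Y → Z} (hΦ : Measurable Φ)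
    {q : Z → Z'} (hq : Measurable q) {r : X → Z'}
    (hqr : ∀ x y, q (Φ (x, y)) = r x) {ψ : Z' → X} (hψ : Measurable ψ) (hψr : ∀ x, ψ (r x) = x)
    {h : Z → ℝ} (hm : Measurable h) (hint : Integrable h ((μ.prod ν).map Φ)) :
    (fun z => ∫ y, h (Φ (ψ (q z), y)) ∂ν) =ᵐ[(μ.prod ν).map Φ]
      ((μ.prod ν).map Φ)[h | mZ'.comap q] := by
  have : IsProbabilityMeasure ((μ.prod ν).map Φ) :=
    Measure.isProbabilityMeasure_map hΦ.aemeasurable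
  let a : X → ℝ := fun x => ∫ y, h (Φ (x, y)) ∂ν
  have hint' : Integrable (fun p => h (Φ p)) (μ.prod ν) := hint.comp_measurable hΦ
  have ha : StronglyMeasurable a :=
    StronglyMeasurable.integral_prod_right' (hm.comp hΦ).stronglyMeasurable
  have hai : Integrable a μ := hint'.integral_prod_left
  have hg : Measurable (fun z => a (ψ (q z))) := ha.measurable.comp (hψ.comp hq)
  have hgΦ : ∀ p : X × Y, a (ψ (q (Φ p))) = a p.1 := fun p => by rw [hqr p.1 p.2, hψr]
  have hgi : Integrable (fun z => a (ψ (q z))) ((μ.prod ν).map Φ) := by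
    rw [integrable_map_measure hg.aestronglyMeasurable hΦ.aemeasurable]
    refine (hai.comp_fst ν).congr (ae_of_all _ fun p => (hgΦ p).symm)
  refine ae_eq_condExp_of_forall_setIntegral_eq hq.comap_le hint
    (fun s _ _ => hgi.integrableOn) ?_ ?_
  · rintro _ ⟨B, hB, rfl⟩ -
    change ∫ z in q ⁻¹' B, a (ψ (q z)) ∂_ = _
    rw [setIntegral_map (hq hB) hg.aestronglyMeasurable hΦ.aemeasurable,
      setIntegral_map (hq hB) hm.aestronglyMeasurable hΦ.aemeasurable]
    -- Events of `σ(q)` pull back to cylinders over `X`, so Fubini compares the two integrals.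
    have hpre : Φ ⁻¹' (q ⁻¹' B) = (r ⁻¹' B) ×ˢ Set.univ := by
      ext ⟨x, y⟩; simp [hqr]
    rw [hpre, setIntegral_prod _ hint'.integrableOn]
    simp_rw [hgΦ]
    rw [setIntegral_prod _ (hai.comp_fst ν).integrableOn]
    simp [a]
  · refine StronglyMeasurable.aestronglyMeasurable ?_
    exact (ha.measurable.comp (hψ.comp (comap_measurable q))).stronglyMeasurable

/-! ### Poincaré inequality on the line. -/

/-- Cauchy–Schwarz, read off from `0 ≤ ∫ (f' - c) ^ 2` with `c` the mean slope. -/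
theorem sq_sub_le_mul_integral_deriv_sq {f : ℝ → ℝ} (hf : ContDiff ℝ 1 f) {x y : ℝ}
    (hxy : x < y) : (f x - f y) ^ 2 ≤ (y - x) * ∫ s in x..y, deriv f s ^ 2 := by
  have hc : Continuous (deriv f) := hf.continuous_deriv le_rfl
  have hI : ∫ s in x..y, deriv f s = f y - f x :=
    intervalIntegral.integral_deriv_eq_sub (fun s _ => (hf.differentiable one_ne_zero) s)
      (hc.intervalIntegrable _ _)
  have hpos : 0 < y - x := sub_pos.2 hxy
  set c := (f y - f x) / (y - x) with hcdef
  have h0 : 0 ≤ ∫ s in x..y, (deriv f s - c) ^ 2 :=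
    intervalIntegral.integral_nonneg hxy.le fun s _ => sq_nonneg _
  have hexp : ∫ s in x..y, (deriv f s - c) ^ 2
      = (∫ s in x..y, deriv f s ^ 2) - 2 * c * (f y - f x) + c ^ 2 * (y - x) := by
    have : ∀ s, (deriv f s - c) ^ 2 = deriv f s ^ 2 - 2 * c * deriv f s + c ^ 2 :=
      fun s => by ring
    simp_rw [this]
    rw [intervalIntegral.integral_add, intervalIntegral.integral_sub,
      intervalIntegral.integral_const_mul, hI]
    · simp; ring
    all_goals exact Continuous.intervalIntegrable (by fun_prop) _ _
  have hce : c * (y - x) = f y - f x := by rw [hcdef]; field_simp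
  rw [hexp] at h0
  have := mul_nonneg hpos.le h0
  nlinarith [hce]

/-- This antiderivative makes the truncated first moments explicit. -/
theorem hasDerivAt_neg_gaussianPDFReal (s : ℝ) :
    HasDerivAt (fun s => -gaussianPDFReal 0 1 s) (gaussianPDFReal 0 1 s * s) s := by
  simp only [gaussianPDFReal_def, sub_zero, NNReal.coe_one, mul_one]
  have h := (((hasDerivAt_pow 2 s).neg.div_const 2).exp.const_mul (√(2 * Real.pi))⁻¹).neg
  convert! h using 1
  simp; ring

theorem integrable_gaussianPDFReal_mul_id :
    Integrable (fun s => gaussianPDFReal 0 1 s * s) := by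
  simp only [gaussianPDFReal_def, sub_zero, NNReal.coe_one, mul_one]
  refine ((integrable_mul_exp_neg_mul_sq (b := 1 / 2) (by norm_num)).const_mul
    (√(2 * Real.pi))⁻¹).congr (ae_of_all _ fun s => ?_)
  beta_reduce
  rw [show -(1 / 2) * s ^ 2 = -s ^ 2 / 2 by ring]; ring

theorem tendsto_gaussianPDFReal_cocompact :
    Filter.Tendsto (gaussianPDFReal 0 1) (Filter.cocompact ℝ) (nhds 0) := by
  have h := (tendsto_rpow_abs_mul_exp_neg_mul_sq_cocompact (a := 1 / 2) (by norm_num) 0).const_mul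
    (√(2 * Real.pi))⁻¹
  rw [mul_zero] at h
  refine h.congr fun s => ?_
  rw [show -(1 / 2) * s ^ 2 = -s ^ 2 / 2 by ring]
  simp [gaussianPDFReal_def]

theorem setIntegral_id_gaussianReal {t : Set ℝ} (ht : MeasurableSet t) :
    ∫ x in t, x ∂gaussianReal 0 1 = ∫ x in t, gaussianPDFReal 0 1 x * x := by
  rw [gaussianReal_of_var_ne_zero _ one_ne_zero,
    setIntegral_withDensity_eq_setIntegral_toReal_smul₀
      (measurable_gaussianPDF _ _).aemeasurable (ae_of_all _ fun _ => gaussianPDF_lt_top) _ ht]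
  simp [toReal_gaussianPDF]

theorem setIntegral_Ici_id_gaussianReal (s : ℝ) :
    ∫ x in Set.Ici s, x ∂gaussianReal 0 1 = gaussianPDFReal 0 1 s := by
  rw [setIntegral_id_gaussianReal measurableSet_Ici, integral_Ici_eq_integral_Ioi,
    integral_Ioi_of_hasDerivAt_of_tendsto' (fun x _ => hasDerivAt_neg_gaussianPDFReal x)
      integrable_gaussianPDFReal_mul_id.integrableOn (m := 0) (by
        simpa using (tendsto_gaussianPDFReal_cocompact.mono_left atTop_le_cocompact).neg)]
  simp

theorem setIntegral_Iio_id_gaussianReal (s : ℝ) :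
    ∫ x in Set.Iio s, x ∂gaussianReal 0 1 = -gaussianPDFReal 0 1 s := by
  rw [setIntegral_id_gaussianReal measurableSet_Iio, ← integral_Iic_eq_integral_Iio,
    integral_Iic_of_hasDerivAt_of_tendsto' (fun x _ => hasDerivAt_neg_gaussianPDFReal x)
      integrable_gaussianPDFReal_mul_id.integrableOn (m := 0) (by
        simpa using (tendsto_gaussianPDFReal_cocompact.mono_left atBot_le_cocompact).neg)]
  simp

/-- The mean length of the segment between two independent standard Gaussian points, restricted
to the event that it covers `s` from left to right, is the Gaussian density at `s`. -/
theorem lintegral_lintegral_sub_gaussianReal (s : ℝ) :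
    ∫⁻ x in Set.Iio s, ∫⁻ y in Set.Ici s, ENNReal.ofReal (y - x)
      ∂gaussianReal 0 1 ∂gaussianReal 0 1 = gaussianPDF 0 1 s := by
  set γ := gaussianReal 0 1
  set G := γ.real (Set.Ici s)
  have hid : Integrable (fun x : ℝ => x) γ := IsGaussian.integrable_id
  have hval : ∀ x, ∫ y in Set.Ici s, (y - x) ∂γ = gaussianPDFReal 0 1 s - x * G := fun x => by
    rw [integral_sub hid.integrableOn (integrable_const _), setIntegral_Ici_id_gaussianReal]
    simp [G, mul_comm]
  have hin : ∀ x ∈ Set.Iio s, ∫⁻ y in Set.Ici s, ENNReal.ofReal (y - x) ∂γ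
      = ENNReal.ofReal (gaussianPDFReal 0 1 s - x * G) := fun x hx => by
    rw [← hval, ofReal_integral_eq_lintegral_ofReal (f := fun y => y - x)
      (hid.integrableOn.sub (integrable_const _))]
    filter_upwards [ae_restrict_mem measurableSet_Ici] with y hy
    exact sub_nonneg.2 (hx.out.le.trans hy)
  have hsum : γ.real (Set.Iio s) + G = 1 := by
    rw [← Set.compl_Ici, probReal_compl_eq_one_sub measurableSet_Ici]
    simp [G]
  rw [setLIntegral_congr_fun measurableSet_Iio hin, ← ofReal_integral_eq_lintegral_ofReal
    (f := fun x => gaussianPDFReal 0 1 s - x * G) ((integrable_const _).sub (hid.integrableOn.mul_const _)), gaussianPDF]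
  · congr 1
    rw [integral_sub (integrable_const _) (hid.integrableOn.mul_const _), integral_mul_const,
      setIntegral_Iio_id_gaussianReal]
    simp only [integral_const, measureReal_restrict_apply_univ, smul_eq_mul]
    linear_combination gaussianPDFReal 0 1 s * hsum
  · filter_upwards [ae_restrict_mem measurableSet_Iio] with x hx
    change 0 ≤ _
    rw [← hval]
    exact setIntegral_nonneg measurableSet_Ici fun y hy => sub_nonneg.2 (hx.out.le.trans hy)

/-- Poincaré inequality for the standard Gaussian measure on the line. -/
theorem doubleVar_gaussianReal_le {f : ℝ → ℝ} (hf : ContDiff ℝ 1 f) :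
    doubleVar (gaussianReal 0 1) f
      ≤ 2 * ∫⁻ s, ENNReal.ofReal (deriv f s ^ 2) ∂gaussianReal 0 1 := by
  set γ := gaussianReal 0 1
  have hc : Continuous (deriv f) := hf.continuous_deriv le_rfl
  -- At `(s, x, y)`: the length of the segment from `x` to `y` if it covers `s` from left to right,
  -- else 0.
  let k : ℝ × ℝ × ℝ → ENNReal :=
    {p | p.2.1 < p.1 ∧ p.1 ≤ p.2.2}.indicator fun p => ENNReal.ofReal (p.2.2 - p.2.1)
  have hk : Measurable k := by
    refine Measurable.indicator (by fun_prop) ?_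
    exact (measurableSet_lt measurable_snd.fst measurable_fst).inter
      (measurableSet_le measurable_fst measurable_snd.snd)
  have hkint : ∀ s, ∫⁻ x, ∫⁻ y, k (s, x, y) ∂γ ∂γ = gaussianPDF 0 1 s := fun s => by
    rw [← lintegral_lintegral_sub_gaussianReal s, ← lintegral_indicator measurableSet_Iio]
    refine lintegral_congr fun x => ?_
    by_cases hx : x < s
    · rw [Set.indicator_of_mem (show x ∈ Set.Iio s from hx),
        ← lintegral_indicator measurableSet_Ici]
      exact lintegral_congr fun y => by simp [k, Set.indicator_apply, hx]
    · rw [Set.indicator_of_notMem (show x ∉ Set.Iio s from hx)]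
      simp [k, hx]
  have hlt : ∀ x y, x < y → ENNReal.ofReal ((f x - f y) ^ 2)
      ≤ ∫⁻ s, ENNReal.ofReal (deriv f s ^ 2) * k (s, x, y) := fun x y hxy => by
    have hcI : IntegrableOn (fun s => deriv f s ^ 2) (Set.Ioc x y) :=
      (hc.pow 2).integrableOn_Ioc
    refine (ENNReal.ofReal_le_ofReal (sq_sub_le_mul_integral_deriv_sq hf hxy)).trans_eq ?_
    rw [ENNReal.ofReal_mul (sub_pos.2 hxy).le, intervalIntegral.integral_of_le hxy.le,
      ofReal_integral_eq_lintegral_ofReal hcI (ae_of_all _ fun s => sq_nonneg _),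
      ← lintegral_indicator measurableSet_Ioc, ← lintegral_const_mul _
        ((Measurable.indicator (by fun_prop) measurableSet_Ioc))]
    refine lintegral_congr fun s => ?_
    by_cases hs : x < s ∧ s ≤ y
    · simp [k, hs, mul_comm]
    · simp [k, hs]
  have hpt : ∀ x y, ENNReal.ofReal ((f x - f y) ^ 2)
      ≤ ∫⁻ s, ENNReal.ofReal (deriv f s ^ 2) * (k (s, x, y) + k (s, y, x)) := fun x y => by
    rcases lt_trichotomy x y with hxy | rfl | hxy
    · exact (hlt x y hxy).trans (lintegral_mono fun s => by gcongr; exact le_self_add)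
    · simp
    · rw [← neg_sub, neg_sq]
      exact (hlt y x hxy).trans (lintegral_mono fun s => by gcongr; exact le_add_self)
  calc doubleVar γ f
      ≤ ∫⁻ x, ∫⁻ y, ∫⁻ s, ENNReal.ofReal (deriv f s ^ 2) * (k (s, x, y) + k (s, y, x))
          ∂volume ∂γ ∂γ :=
        lintegral_mono fun x => lintegral_mono (hpt x)
    _ = ∫⁻ x, ∫⁻ s, ∫⁻ y, ENNReal.ofReal (deriv f s ^ 2) * (k (s, x, y) + k (s, y, x))
          ∂γ ∂volume ∂γ :=
        lintegral_congr fun x => lintegral_lintegral_swap (Measurable.aemeasurable (by fun_prop))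
    _ = ∫⁻ s, ∫⁻ x, ∫⁻ y, ENNReal.ofReal (deriv f s ^ 2) * (k (s, x, y) + k (s, y, x)) ∂γ ∂γ :=
        lintegral_lintegral_swap (f := fun x s =>
          ∫⁻ y, ENNReal.ofReal (deriv f s ^ 2) * (k (s, x, y) + k (s, y, x)) ∂γ) (Measurable.aemeasurable (by fun_prop))
    _ = ∫⁻ s, 2 * (gaussianPDF 0 1 s * ENNReal.ofReal (deriv f s ^ 2)) := by
        refine lintegral_congr fun s => ?_
        -- Both orientations have the same mean, whence the factor 2.
        have hswap : ∫⁻ x, ∫⁻ y, k (s, y, x) ∂γ ∂γ = ∫⁻ x, ∫⁻ y, k (s, x, y) ∂γ ∂γ :=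
          lintegral_lintegral_swap (Measurable.aemeasurable (by fun_prop))
        calc _ = ∫⁻ x, ENNReal.ofReal (deriv f s ^ 2) *
                  (∫⁻ y, k (s, x, y) ∂γ + ∫⁻ y, k (s, y, x) ∂γ) ∂γ := by
              refine lintegral_congr fun x => ?_
              rw [lintegral_const_mul _ (by fun_prop), lintegral_add_left (by fun_prop)]
          _ = _ := by
              rw [lintegral_const_mul _ (by fun_prop), lintegral_add_left (by fun_prop), hswap,
                hkint]
              ring
    _ = 2 * ∫⁻ s, ENNReal.ofReal (deriv f s ^ 2) ∂γ := by
        rw [lintegral_const_mul _ (by fun_prop)]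
        congr 1
        rw [show γ = _ from gaussianReal_of_var_ne_zero _ one_ne_zero,
          lintegral_withDensity_eq_lintegral_mul _ (measurable_gaussianPDF _ _) (by fun_prop)]
        rfl

/-! ### Poincaré inequality in finite dimension. -/

theorem fderiv_comp_const_add_clm {E F : Type*} [NormedAddCommGroup E] [NormedSpace ℝ E]
    [NormedAddCommGroup F] [NormedSpace ℝ F] {f : F → ℝ} (hf : ContDiff ℝ 1 f) (c : F)
    (L : E →L[ℝ] F) (x : E) :
    fderiv ℝ (fun y => f (c + L y)) x = (fderiv ℝ f (c + L x)).comp L := by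
  have h := (hf.differentiable one_ne_zero (c + L x)).hasFDerivAt.comp x
    (L.hasFDerivAt.const_add c)
  exact h.fderiv

/-- Poincaré inequality for the product of standard Gaussian measures. -/
theorem doubleVar_pi_gaussianReal_le (n : ℕ) {f : (Fin n → ℝ) → ℝ} (hf : ContDiff ℝ 1 f) :
    doubleVar (Measure.pi fun _ : Fin n => gaussianReal 0 1) f
      ≤ 2 * ∫⁻ x, ∑ i, ENNReal.ofReal (fderiv ℝ f x (Pi.single i 1) ^ 2)
        ∂(Measure.pi fun _ : Fin n => gaussianReal 0 1) := by
  induction n with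
  | zero =>
    have h0 : ∀ x y, f x - f y = 0 := fun x y => by rw [Subsingleton.elim x y, sub_self]
    simp [doubleVar, h0]
  | succ n ih =>
    let γ := gaussianReal 0 1
    let π := Measure.pi fun _ : Fin n => γ
    let L₁ : ℝ →L[ℝ] Fin (n + 1) → ℝ := ContinuousLinearMap.toSpanSingleton ℝ (Pi.single 0 1)
    let L₂ : (Fin n → ℝ) →L[ℝ] Fin (n + 1) → ℝ :=
      ContinuousLinearMap.pi (Fin.cons 0 fun i => ContinuousLinearMap.proj i)
    let T : ℝ × (Fin n → ℝ) → Fin (n + 1) → ℝ := fun p => L₁ p.1 + L₂ p.2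
    have hT : Measurable T := by fun_prop
    have hL₁ : L₁ 1 = Pi.single 0 1 := by simp [L₁]
    have hL₂ : ∀ i, L₂ (Pi.single i 1) = Pi.single i.succ 1 := fun i => by
      ext j
      refine Fin.cases ?_ (fun j => ?_) j
      · simp [L₂]
      · simp [L₂, Pi.single_apply]
    have hmap : (Measure.pi fun _ : Fin (n + 1) => γ) = (γ.prod π).map T := by
      rw [← (measurePreserving_piFinSuccAbove (fun _ : Fin (n + 1) => γ) 0).symm.map_eq]
      congr 1
      funext p
      ext j
      refine Fin.cases ?_ (fun j => ?_) j
      · simp [T, L₁, L₂, MeasurableEquiv.piFinSuccAbove_symm_apply, Fin.insertNthEquiv]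
      · simp [T, L₁, L₂, MeasurableEquiv.piFinSuccAbove_symm_apply, Fin.insertNthEquiv]
    have hcont : Continuous (fderiv ℝ f) := hf.continuous_fderiv one_ne_zero
    have hm : ∀ i, Measurable fun x => ENNReal.ofReal (fderiv ℝ f x (Pi.single i 1) ^ 2) :=
      fun i =>
        (Continuous.measurable (by fun_prop : Continuous fun x =>
          fderiv ℝ f x (Pi.single i 1) ^ 2)).ennreal_ofReal
    have hmT : ∀ i, Measurable fun p => ENNReal.ofReal (fderiv ℝ f (T p) (Pi.single i 1) ^ 2) :=
      fun i => (hm i).comp hT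
    rw [hmap, doubleVar_map _ hT hf.continuous.measurable,
      lintegral_map (Finset.measurable_sum _ fun i _ => hm i) hT]
    simp_rw [Fin.sum_univ_succ]
    rw [lintegral_add_left (hmT 0), mul_add]
    refine ((doubleVar_prod_le γ π (hf.continuous.measurable.comp hT)).trans_eq
      (add_comm _ _)).trans (add_le_add ?_ ?_)
    · rw [lintegral_prod_symm _ (hmT 0).aemeasurable,
        ← lintegral_const_mul']
      · refine lintegral_mono fun y => ?_
        have hcomm : (fun x => (f ∘ T) (x, y)) = fun x => f (L₂ y + L₁ x) := by
          funext x; simp [T, add_comm]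
        rw [hcomm]
        refine (doubleVar_gaussianReal_le (f := fun x => f (L₂ y + L₁ x))
          (by fun_prop)).trans_eq ?_
        simp_rw [← fderiv_apply_one_eq_deriv, fderiv_comp_const_add_clm hf,
          ContinuousLinearMap.comp_apply, hL₁]
        simp only [T, add_comm (L₂ y)]
        rfl
      · simp
    · rw [lintegral_prod _ (Measurable.aemeasurable
        (Finset.measurable_sum _ fun i _ => hmT (Fin.succ i))), ← lintegral_const_mul']
      · refine lintegral_mono fun a => ?_
        refine (ih (f := fun y => f (L₁ a + L₂ y)) (by fun_prop)).trans_eq ?_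
        simp_rw [fderiv_comp_const_add_clm hf, ContinuousLinearMap.comp_apply, hL₂]
        rfl
      · simp

/-- Poincaré inequality for the standard Gaussian measure on a Euclidean space. -/
theorem doubleVar_stdGaussian_le {E : Type*} [NormedAddCommGroup E] [InnerProductSpace ℝ E]
    [FiniteDimensional ℝ E] [MeasurableSpace E] [BorelSpace E] {f : E → ℝ}
    (hf : ContDiff ℝ 1 f) :
    doubleVar (stdGaussian E) f
      ≤ 2 * ∫⁻ x, ENNReal.ofReal (‖fderiv ℝ f x‖ ^ 2) ∂(stdGaussian E) := by
  let b := stdOrthonormalBasis ℝ E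
  let T : (Fin (Module.finrank ℝ E) → ℝ) →L[ℝ] E :=
    ∑ i, (ContinuousLinearMap.proj i).smulRight (b i)
  have hTa : ∀ x, T x = ∑ i, x i • b i := fun x => by simp [T]
  have hTs : ∀ i, T (Pi.single i 1) = b i := fun i => by simp [hTa, Pi.single_apply]
  have hmap : stdGaussian E = (Measure.pi fun _ => gaussianReal 0 1).map T := by
    rw [stdGaussian]
    congr 1
    funext x
    exact (hTa x).symm
  have hTm : Measurable T := T.continuous.measurable
  have hcont : Continuous (fderiv ℝ f) := hf.continuous_fderiv one_ne_zero
  rw [hmap, doubleVar_map _ hTm hf.continuous.measurable,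
    lintegral_map (f := fun x => ENNReal.ofReal (‖fderiv ℝ f x‖ ^ 2))
      (hcont.norm.pow 2).measurable.ennreal_ofReal hTm]
  -- The summand `0` gives the affine form required by `fderiv_comp_const_add_clm`.
  have h := doubleVar_pi_gaussianReal_le _ (f := fun x => f (0 + T x)) (by fun_prop)
  simp_rw [fderiv_comp_const_add_clm hf, ContinuousLinearMap.comp_apply, hTs, zero_add] at h
  refine h.trans_eq ?_
  congr 1
  refine lintegral_congr fun x => ?_
  rw [b.norm_dual, ENNReal.ofReal_sum_of_nonneg fun i _ => sq_nonneg _]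

/-! ### Gaussian splitting and the projected gradient. -/

/-- A standard Gaussian vector is the sum of independent standard Gaussian vectors in two
orthogonal complements. -/
theorem stdGaussian_eq_map_add_prod {E : Type*} [NormedAddCommGroup E] [InnerProductSpace ℝ E]
    [FiniteDimensional ℝ E] [MeasurableSpace E] [BorelSpace E] (K : Submodule ℝ E) :
    stdGaussian E = ((stdGaussian Kᗮ).prod (stdGaussian K)).map
      (fun p => (p.1 : E) + (p.2 : E)) := by
  have hsub : ∀ (V : Submodule ℝ E) (t : E), charFun ((stdGaussian V).map (V.subtypeL)) t
      = charFun (stdGaussian V) (V.orthogonalProjectionOnto t) := fun V t => by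
    rw [charFun_apply, integral_map (by fun_prop) (by fun_prop), charFun_apply]
    simp
  have hprod : ((stdGaussian Kᗮ).prod (stdGaussian K)).map (fun p => (p.1 : E) + (p.2 : E))
      = (((stdGaussian Kᗮ).map Kᗮ.subtypeL).prod ((stdGaussian K).map K.subtypeL)).map
        (fun p => p.1 + p.2) := by
    rw [Measure.map_prod_map _ _ (by fun_prop) (by fun_prop),
      Measure.map_map (by fun_prop) (by fun_prop)]
    rfl
  have hp1 : IsProbabilityMeasure ((stdGaussian Kᗮ).map Kᗮ.subtypeL) :=
    Measure.isProbabilityMeasure_map (by fun_prop)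
  have hp2 : IsProbabilityMeasure ((stdGaussian K).map K.subtypeL) :=
    Measure.isProbabilityMeasure_map (by fun_prop)
  rw [hprod]
  refine Measure.ext_of_charFun ?_
  rw [charFun_map_add_prod_eq_mul]
  funext t
  rw [Pi.mul_apply, hsub, hsub, charFun_stdGaussian, charFun_stdGaussian, charFun_stdGaussian,
    ← Complex.exp_add]
  congr 1
  -- Pythagoras factors the characteristic function `exp (-‖t‖ ^ 2 / 2)`.
  have := K.norm_sq_eq_add_norm_sq_projection t
  rw [← Complex.ofReal_pow, this]
  push_cast
  simp
  ring

/-- Along a subspace that `B` maps into the kernel of `P`, where `B` is a self-adjoint square root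
of `S`, the derivative of `h` only sees the projected gradient. -/
theorem norm_sq_fderiv_comp_le_weightedNormSq {d : ℕ} {S B : Matrix (Fin d) (Fin d) ℝ}
    (hBB : B * B = S) (hBt : Bᵀ = B) (P : Matrix (Fin d) (Fin d) ℝ)
    {h : EuclideanSpace ℝ (Fin d) → ℝ} {x : EuclideanSpace ℝ (Fin d)}
    (K : Submodule ℝ (EuclideanSpace ℝ (Fin d)))
    (hK : ∀ k ∈ K, Matrix.toEuclideanCLM (𝕜 := ℝ) P (Matrix.toEuclideanCLM (𝕜 := ℝ) B k) = 0) :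
    ‖(fderiv ℝ h x).comp ((Matrix.toEuclideanCLM (𝕜 := ℝ) B).comp K.subtypeL)‖ ^ 2
      ≤ weightedNormSq S (Matrix.toEuclideanCLM (𝕜 := ℝ) (1 - Pᵀ) (gradient h x)) := by
  have hadj : ∀ (M : Matrix (Fin d) (Fin d) ℝ) (u v : EuclideanSpace ℝ (Fin d)),
      inner ℝ u (Matrix.toEuclideanCLM (𝕜 := ℝ) M v)
        = inner ℝ (Matrix.toEuclideanCLM (𝕜 := ℝ) Mᵀ u) v := fun M u v => by
    rw [← Matrix.conjTranspose_eq_transpose_of_trivial, ← Matrix.star_eq_conjTranspose, map_star,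
      ContinuousLinearMap.star_eq_adjoint, ContinuousLinearMap.adjoint_inner_left]
  set v := Matrix.toEuclideanCLM (𝕜 := ℝ) (1 - Pᵀ) (gradient h x) with hv
  have hw : weightedNormSq S v = ‖Matrix.toEuclideanCLM (𝕜 := ℝ) B v‖ ^ 2 := by
    rw [weightedNormSq, ← hBB, map_mul, mul_apply_eq_comp, hadj, hBt,
      real_inner_self_eq_norm_sq]
  rw [hw]
  gcongr
  refine ContinuousLinearMap.opNorm_le_bound _ (norm_nonneg _) fun k => ?_
  -- `P` kills `B k`, so `1 - P` fixes it; taking adjoints moves `1 - P` onto the gradient.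
  have hk : (Matrix.toEuclideanCLM (𝕜 := ℝ) B k : EuclideanSpace ℝ (Fin d))
      = Matrix.toEuclideanCLM (𝕜 := ℝ) (1 - P) (Matrix.toEuclideanCLM (𝕜 := ℝ) B k) := by
    rw [map_sub, map_one, _root_.sub_apply, hK k k.2]
    simp
  have heq : (fderiv ℝ h x).comp ((Matrix.toEuclideanCLM (𝕜 := ℝ) B).comp K.subtypeL) k
      = inner ℝ (Matrix.toEuclideanCLM (𝕜 := ℝ) B v) (k : EuclideanSpace ℝ (Fin d)) := by
    have hg : ∀ u, fderiv ℝ h x u = inner ℝ (gradient h x) u := fun u => by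
      rw [gradient, InnerProductSpace.toDual_symm_apply]
    change fderiv ℝ h x (Matrix.toEuclideanCLM (𝕜 := ℝ) B k) = _
    rw [hg, hk, hadj, Matrix.transpose_sub, Matrix.transpose_one, ← hv, hadj, hBt]
  rw [heq]
  exact norm_inner_le_norm _ _

open scoped MatrixOrder in
theorem exists_multivariateGaussian_eq_map {d : ℕ} (m : EuclideanSpace ℝ (Fin d))
    {S : Matrix (Fin d) (Fin d) ℝ} (hS : S.PosSemidef) :
    ∃ B : Matrix (Fin d) (Fin d) ℝ, B * B = S ∧ Bᵀ = B ∧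
      multivariateGaussian m S = (stdGaussian (EuclideanSpace ℝ (Fin d))).map
        (fun x => m + Matrix.toEuclideanCLM (𝕜 := ℝ) B x) := by
  refine ⟨CFC.sqrt S, CFC.sqrt_mul_sqrt_self _ hS.nonneg, ?_, rfl⟩
  rw [← Matrix.conjTranspose_eq_transpose_of_trivial]
  exact IsSelfAdjoint.of_nonneg (CFC.sqrt_nonneg S)

/-! ### The subspace inequality. -/

theorem proposition2p3 {d : ℕ} (m : EuclideanSpace ℝ (Fin d))
    (S : Matrix (Fin d) (Fin d) ℝ) (hS : S.PosDef)
    (P : Matrix (Fin d) (Fin d) ℝ) (hP : P * P = P)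
    (h : EuclideanSpace ℝ (Fin d) → ℝ) (hC1 : ContDiff ℝ 1 h)
    (hint : Integrable h (multivariateGaussian m S)) :
    ∫⁻ x, ENNReal.ofReal ((h x - ((multivariateGaussian m S)[h | sigmaAlgebraOf P]) x) ^ 2)
        ∂(multivariateGaussian m S)
      ≤ ∫⁻ x, ENNReal.ofReal
          (weightedNormSq S (Matrix.toEuclideanCLM (𝕜 := ℝ) (1 - Pᵀ) (gradient h x)))
        ∂(multivariateGaussian m S) := by
  obtain ⟨B, hBB, hBt, hBμ⟩ := exists_multivariateGaussian_eq_map m hS.posSemidef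
  have hBu : IsUnit B.det := by
    have hdet : B.det * B.det = S.det := by rw [← Matrix.det_mul, hBB]
    refine isUnit_iff_ne_zero.2 fun h0 => hS.det_pos.ne' ?_
    rw [← hdet, h0, zero_mul]
  let A := Matrix.toEuclideanCLM (𝕜 := ℝ) B
  let C := Matrix.toEuclideanCLM (𝕜 := ℝ) B⁻¹
  let Q := Matrix.toEuclideanCLM (𝕜 := ℝ) P
  have hCA : ∀ x, C (A x) = x := fun x => by
    rw [← mul_apply_eq_comp, ← map_mul, Matrix.nonsing_inv_mul _ hBu, map_one]; rfl
  have hAC : ∀ x, A (C x) = x := fun x => by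
    rw [← mul_apply_eq_comp, ← map_mul, Matrix.mul_nonsing_inv _ hBu, map_one]; rfl
  have hQQ : ∀ x, Q (Q x) = Q x := fun x => by
    rw [← mul_apply_eq_comp, ← map_mul, hP]
  let K : Submodule ℝ (EuclideanSpace ℝ (Fin d)) := LinearMap.ker (Q.comp A).toLinearMap
  have hK : ∀ k, k ∈ K ↔ Q (A k) = 0 := fun k => LinearMap.mem_ker
  let ν₁ := stdGaussian Kᗮ
  let ν₂ := stdGaussian K
  let Φ : Kᗮ × K → EuclideanSpace ℝ (Fin d) := fun p => m + A (p.1 + p.2)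
  have hΦ : Measurable Φ := by fun_prop
  have hμ : multivariateGaussian m S = (ν₁.prod ν₂).map Φ := by
    rw [hBμ, stdGaussian_eq_map_add_prod K,
      Measure.map_map (by fun_prop) (by fun_prop)]
    rfl
  let W := Kᗮ.orthogonalProjectionOnto
  have hW : ∀ k ∈ K, W k = 0 := fun k hk =>
    Submodule.orthogonalProjectionOnto_orthogonal_apply_eq_zero hk
  -- Idempotence enters here: `A` sends `C (Q x) - C x` to `Q x - x`, which `Q` kills.
  have hWC : ∀ x, W (C (Q x)) = W (C x) := fun x => by
    rw [← sub_eq_zero, ← map_sub, ← map_sub]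
    exact hW _ ((hK _).2 (by rw [hAC, map_sub, hQQ, sub_self]))
  rw [hμ] at hint ⊢
  -- `ψ` recovers the `Kᗮ` component `w` from `Q (m + A w)`.
  have hce := condExp_map_prod_ae_eq ν₁ ν₂ hΦ (q := fun x => Q x) (by fun_prop)
    (r := fun w => Q (m + A w))
    (fun w k => by
      have := (hK _).1 k.2
      simp [Φ, this])
    (ψ := fun z => W (C z) - W (C m)) (by fun_prop)
    (fun w => by
      rw [hWC, map_add, map_add, hCA, add_sub_cancel_left]
      simp [W]) hC1.continuous.measurable hint
  have hslice : ∀ᵐ w ∂ν₁, Integrable (fun k => h (Φ (w, k))) ν₂ :=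
    ((hint.comp_measurable hΦ).prod_right_ae)
  have hcontD : Continuous (fderiv ℝ h) := hC1.continuous_fderiv one_ne_zero
  have hcg : Continuous (gradient h) :=
    (InnerProductSpace.toDual ℝ _).symm.continuous.comp hcontD
  have hmR : Measurable fun x => ENNReal.ofReal
      (weightedNormSq S (Matrix.toEuclideanCLM (𝕜 := ℝ) (1 - Pᵀ) (gradient h x))) := by
    refine Measurable.ennreal_ofReal (Continuous.measurable ?_)
    unfold weightedNormSq
    fun_prop
  have hψ : ∀ w k, W (C (Q (Φ (w, k)))) - W (C m) = w := fun w k => by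
    rw [hWC]
    simp only [Φ, map_add, hCA]
    rw [hW k k.2]
    simp [W]
  have ham : Measurable fun w : Kᗮ => ∫ k, h (Φ (w, k)) ∂ν₂ :=
    (StronglyMeasurable.integral_prod_right'
      (hC1.continuous.measurable.comp hΦ).stronglyMeasurable).measurable
  have hgm : Measurable fun x => ∫ k, h (Φ (W (C (Q x)) - W (C m), k)) ∂ν₂ :=
    ham.comp (by fun_prop)
  have hhm := hC1.continuous.measurable
  have hlhs : ∀ᵐ x ∂(ν₁.prod ν₂).map Φ,
      ENNReal.ofReal ((h x - (((ν₁.prod ν₂).map Φ)[h | sigmaAlgebraOf P]) x) ^ 2)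
        = ENNReal.ofReal ((h x - ∫ k, h (Φ (W (C (Q x)) - W (C m), k)) ∂ν₂) ^ 2) := by
    filter_upwards [hce] with x hx
    rw [hx]
  rw [lintegral_congr_ae hlhs, lintegral_map (by fun_prop) hΦ, lintegral_map hmR hΦ,
    lintegral_prod _ (Measurable.aemeasurable ?_), lintegral_prod _ (Measurable.aemeasurable ?_)]
  rotate_left
  · exact hmR.comp hΦ
  · exact (((hhm.sub hgm).pow_const 2).ennreal_ofReal).comp hΦ
  refine lintegral_mono_ae ?_
  filter_upwards [hslice] with w hw
  simp_rw [hψ]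
  have hΦw : (fun k : K => h (Φ (w, k))) = fun k => h ((m + A w) + (A.comp K.subtypeL) k) := by
    funext k; simp [Φ, add_assoc]
  -- For fixed `w` the inner integral is the variance of the slice over `K`.
  rw [← evariance_eq_lintegral_ofReal]
  refine (ENNReal.mul_le_mul_iff_right two_ne_zero ENNReal.ofNat_ne_top).1
    ((two_mul_evariance_le_doubleVar hw).trans ?_)
  rw [hΦw]
  refine (doubleVar_stdGaussian_le (by fun_prop)).trans ?_
  gcongr with k
  rw [fderiv_comp_const_add_clm hC1]
  have hpt : (m + A w) + (A.comp K.subtypeL) k = Φ (w, k) := by simp [Φ, add_assoc]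
  rw [hpt]
  exact norm_sq_fderiv_comp_le_weightedNormSq hBB hBt P K
    fun k hk => (hK k).1 hk
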